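/- Let $X$ be the graph with vertex set $\mathbb{Z}^2$ in which two vertices $(x,y)$ and $(x',y')$ are joined by an edge if and only if $|x-x'|+|y-y'|=1$. For $A\subset\mathbb{Z}^2$, let $\partial A$ be the set of vertices of $\mathbb{Z}^2\setminus A$ that are adjacent in $X$ to some vertex of $A$. A nonempty finite set $A\subset\mathbb{Z}^2$ is called \emph{minimal} if $|\partial A|\le|\partial B|$ for every $B\subset\mathbb{Z}^2$ with $|B|=|A|$. Two sets $A,B\subset\mathbb{Z}^2$ are \emph{congruent} if $\phi(A)=B$ for some graph automorphism $\phi$ of $X$. Let $\mathcal{G}$ be the graph whose vertices are the congruence classes of minimal sets, where two vertices $v$ and $w$ are joined by an edge if and only if there are minimal sets $A\in v$ and $B\in w$ whose symmetric difference has exactly one element. Then $\mathcal{G}$ has exactly one infinite connected component, that is, exactly one connected component with infinitely many vertices. -/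

import Mathlib

namespace MinimalSets

/-- The planar integer lattice `X`: vertex set `ℤ × ℤ`, with edges joining the pairs of vertices
at `ℓ₁`-distance one. -/
def lattice : SimpleGraph (ℤ × ℤ) where
  Adj p q := |p.1 - q.1| + |p.2 - q.2| = 1
  symm := ⟨by
    intro p q h
    rwa [abs_sub_comm q.1 p.1, abs_sub_comm q.2 p.2]⟩
  loopless := ⟨by
    intro p h
    simp at h⟩

/-- The vertex boundary of a set `A` of vertices of a graph: the vertices outside `A` that are
adjacent to some vertex of `A`. -/
def vertexBoundary {V : Type*} (X : SimpleGraph V) (A : Set V) : Set V :=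
  {u | u ∉ A ∧ ∃ v ∈ A, X.Adj u v}

/-- A minimal set of vertices of `X`: a nonempty finite set whose vertex boundary has the least
size among the vertex boundaries of all sets with the same number of vertices. -/
structure IsMinimal {V : Type*} (X : SimpleGraph V) (A : Set V) : Prop where
  nonempty : A.Nonempty
  finite : A.Finite
  boundary_le : ∀ B : Set V, B.encard = A.encard →
    (vertexBoundary X A).encard ≤ (vertexBoundary X B).encard

/-- Two sets of vertices are congruent if a graph automorphism carries one onto the other. -/
def Congruent {V : Type*} (X : SimpleGraph V) (A B : Set V) : Prop :=
  ∃ φ : X ≃g X, φ '' A = B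

theorem Congruent.encard_eq {V : Type*} {X : SimpleGraph V} {A B : Set V}
    (h : Congruent X A B) : A.encard = B.encard := by
  obtain ⟨φ, rfl⟩ := h
  exact (φ.injective.encard_image A).symm

/-- Congruence, as an equivalence relation on the minimal sets of `X`. -/
def congruence {V : Type*} (X : SimpleGraph V) : Setoid {A : Set V // IsMinimal X A} where
  r A B := Congruent X A.1 B.1
  iseqv := by
    refine ⟨fun A => ⟨SimpleGraph.Iso.refl, ?_⟩, ?_, ?_⟩
    · exact Set.image_id A.1
    · rintro ⟨A, hA⟩ ⟨B, hB⟩ ⟨φ, hφ⟩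
      refine ⟨φ.symm, ?_⟩
      change φ '' A = B at hφ
      change φ.symm '' B = A
      rw [← hφ, Set.image_image]
      simp
    · rintro ⟨A, hA⟩ ⟨B, hB⟩ ⟨C, hC⟩ ⟨φ, hφ⟩ ⟨ψ, hψ⟩
      refine ⟨φ.trans ψ, ?_⟩
      change φ '' A = B at hφ
      change ψ '' B = C at hψ
      change (φ.trans ψ) '' A = C
      rw [← hψ, ← hφ, Set.image_image]
      rfl

/-- Congruence classes of minimal sets of `X`. -/
abbrev MinimalClass {V : Type*} (X : SimpleGraph V) : Type _ := Quotient (congruence X)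

theorem encard_symmDiff_ne_one {V : Type*} {A B : Set V} (hA : A.Finite) (hB : B.Finite)
    (h : A.encard = B.encard) : (symmDiff A B).encard ≠ 1 := by
  intro h1
  have e1 := Set.encard_sdiff_add_encard_inter A B
  have e2 := Set.encard_sdiff_add_encard_inter B A
  have e3 : (symmDiff A B).encard = (A \ B).encard + (B \ A).encard :=
    Set.encard_union_eq disjoint_sdiff_sdiff
  rw [Set.inter_comm B A] at e2
  rw [e3] at h1
  have f1 : (A \ B).encard = ((A \ B).ncard : ℕ∞) := (hA.sdiff.cast_ncard_eq).symm
  have f2 : (B \ A).encard = ((B \ A).ncard : ℕ∞) := (hB.sdiff.cast_ncard_eq).symm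
  have f3 : (A ∩ B).encard = ((A ∩ B).ncard : ℕ∞) := ((hA.inter_of_left B).cast_ncard_eq).symm
  rw [← e1, ← e2, f1, f2, f3] at h
  rw [f1, f2] at h1
  norm_cast at h h1
  omega

/-- The graph `𝒢` of minimal sets of `X`: its vertices are the congruence classes of minimal sets,
and two classes are adjacent if they have representatives whose symmetric difference has exactly
one element. -/
def minimalGraph {V : Type*} (X : SimpleGraph V) : SimpleGraph (MinimalClass X) where
  Adj v w := ∃ A B : {A : Set V // IsMinimal X A},
    Quotient.mk (congruence X) A = v ∧ Quotient.mk (congruence X) B = w ∧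
      (symmDiff A.1 B.1).encard = 1
  symm := ⟨by
    rintro v w ⟨A, B, hA, hB, h⟩
    exact ⟨B, A, hB, hA, by rwa [symmDiff_comm]⟩⟩
  loopless := ⟨by
    rintro v ⟨A, B, hA, hB, h⟩
    have hAB : Congruent X A.1 B.1 := Quotient.exact (hA.trans hB.symm)
    exact encard_symmDiff_ne_one A.2.finite B.2.finite hAB.encard_eq h⟩

end MinimalSets

/-!
In the coordinates `(x + y, x - y)` the neighbours of a set of lattice points of one parity form its
sumset with `{-1, 1} ^ 2`, so Cauchy–Davenport in each coordinate bounds the number of neighbours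
from below by the size of the set plus its half-perimeter plus one. Adding the two parities gives
the isoperimetric inequality, and at the sizes `2 r ^ 2 + 2 r + 1` equality forces the set to
be a translate of the closed neighbourhood of a diagonal `r × r` grid.

A minimal set has no wide gap, since the parts on the two sides of a gap could be pushed together to
shrink the boundary; hence there are finitely many classes of each size. Sizes differ by one along
the edges of `𝒢`, so an infinite component contains classes of every large size. Infinitely many
sizes have only one class, so there is at most one infinite component. One exists because adding
points row by row to diagonal boxes whose side lengths differ by at most one passes through minimal
sets only.
-/

namespace MinimalSets

open Filter
open scoped Pointwise

/-! ### Infinite components of a graph with a height function -/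

section Components

variable {V : Type*} {G : SimpleGraph V} {f : V → ℕ}

theorem exists_reachable_apply_eq (hf : ∀ v w, G.Adj v w → f w ≤ f v + 1) {v w : V}
    (h : G.Reachable v w) {m : ℕ} (hv : f v ≤ m) (hw : m ≤ f w) :
    ∃ u, G.Reachable v u ∧ f u = m := by
  obtain ⟨p⟩ := h
  induction p with
  | nil => exact ⟨_, .refl _, le_antisymm hv hw⟩
  | cons hadj _ ih =>
    rcases hv.eq_or_lt with hv | hv
    · exact ⟨_, .refl _, hv⟩
    · obtain ⟨u, hu, hum⟩ := ih ((hf _ _ hadj).trans hv) hw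
      exact ⟨u, hadj.reachable.trans hu, hum⟩

theorem eventually_exists_mem_supp_apply_eq (hf : ∀ v w, G.Adj v w → f w ≤ f v + 1)
    (hfin : ∀ n, {v | f v ≤ n}.Finite) {C : G.ConnectedComponent} (hC : C.supp.Infinite) :
    ∀ᶠ m in atTop, ∃ u ∈ C.supp, f u = m := by
  obtain ⟨v, hv⟩ := C.nonempty_supp
  filter_upwards [eventually_ge_atTop (f v)] with m hm
  obtain ⟨w, hw, hmw⟩ := hC.exists_notMem_finite (hfin m)
  obtain ⟨u, hu, hum⟩ :=
    exists_reachable_apply_eq hf (C.reachable_of_mem_supp hv hw) hm (not_le.1 hmw).le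
  exact ⟨u, (SimpleGraph.ConnectedComponent.sound hu).symm.trans hv, hum⟩

theorem eq_of_infinite_supp (hf : ∀ v w, G.Adj v w → f w ≤ f v + 1)
    (hfin : ∀ n, {v | f v ≤ n}.Finite) (hunique : ∃ᶠ m in atTop, {v | f v = m}.Subsingleton)
    {C D : G.ConnectedComponent} (hC : C.supp.Infinite) (hD : D.supp.Infinite) : C = D := by
  obtain ⟨m, hm, ⟨u, hu, hum⟩, w, hw, hwm⟩ := (hunique.and_eventually
    ((eventually_exists_mem_supp_apply_eq hf hfin hC).and
      (eventually_exists_mem_supp_apply_eq hf hfin hD))).exists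
  rw [← hu, ← hw, hm hum hwm]

end Components

/-! ### Congruence classes and closed neighbourhoods -/

section Classes

variable {V : Type*} {X : SimpleGraph V} {A B : Set V}

theorem vertexBoundary_image (φ : X ≃g X) (A : Set V) :
    vertexBoundary X (φ '' A) = φ '' vertexBoundary X A := by
  ext u
  obtain ⟨u, rfl⟩ := φ.surjective u
  simp only [vertexBoundary, φ.injective.mem_set_image, Set.mem_ofPred_eq, Set.exists_mem_image,
    φ.map_adj_iff]

theorem IsMinimal.of_congruent (hA : IsMinimal X A) (h : Congruent X A B) : IsMinimal X B := by
  have hcard := h.encard_eq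
  obtain ⟨φ, rfl⟩ := h
  refine ⟨hA.nonempty.image _, hA.finite.image _, fun B hB => ?_⟩
  rw [vertexBoundary_image, φ.injective.encard_image]
  exact hA.boundary_le B (hB.trans hcard.symm)

/-- The congruence class of a minimal set, as a vertex of the graph of minimal sets. -/
def IsMinimal.congruenceClass (hA : IsMinimal X A) : MinimalClass X :=
  Quotient.mk (congruence X) ⟨A, hA⟩

theorem IsMinimal.congruenceClass_eq (hA : IsMinimal X A) (hB : IsMinimal X B)
    (h : Congruent X A B) : hA.congruenceClass = hB.congruenceClass :=
  Quotient.sound h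

theorem IsMinimal.adj_insert {w : V} (hA : IsMinimal X A) (hw : w ∉ A)
    (hwA : IsMinimal X (insert w A)) :
    (minimalGraph X).Adj hA.congruenceClass hwA.congruenceClass := by
  refine ⟨⟨A, hA⟩, ⟨_, hwA⟩, rfl, rfl, ?_⟩
  have hdiff : symmDiff A (insert w A) = {w} := by
    rw [symmDiff_of_le (Set.subset_insert w A), Set.insert_sdiff_of_notMem _ hw, sdiff_self]
    exact insert_empty_eq w
  rw [hdiff, Set.encard_singleton]

theorem congruent_image [DecidableEq V] (φ : X ≃g X) (A : Finset V) :
    Congruent X (A : Set V) (A.image φ : Finset V) :=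
  ⟨φ, Finset.coe_image.symm⟩

theorem exists_congruenceClass_eq (v : MinimalClass X) :
    ∃ (A : Finset V) (hA : IsMinimal X (A : Set V)), hA.congruenceClass = v := by
  obtain ⟨⟨A, hA⟩, rfl⟩ := Quotient.exists_rep v
  obtain ⟨A, rfl⟩ := hA.finite.exists_finset_coe
  exact ⟨A, hA, rfl⟩

/-- The number of elements of the minimal sets in a congruence class. -/
noncomputable def classSize : MinimalClass X → ℕ :=
  Quotient.lift (fun A => A.1.ncard) fun _ _ h => congrArg ENat.toNat (Congruent.encard_eq h)

theorem classSize_congruenceClass {A : Finset V} (hA : IsMinimal X (A : Set V)) :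
    classSize hA.congruenceClass = A.card :=
  Set.ncard_coe_finset A

theorem classSize_le_of_adj (v w : MinimalClass X) (h : (minimalGraph X).Adj v w) :
    classSize w ≤ classSize v + 1 := by
  obtain ⟨⟨A, hA⟩, ⟨B, hB⟩, rfl, rfl, h⟩ := h
  change B.ncard ≤ A.ncard + 1
  have hsub : B ⊆ A ∪ symmDiff A B := by
    intro u hu
    rw [Set.mem_union, Set.mem_symmDiff]
    tauto
  calc B.ncard ≤ (A ∪ symmDiff A B).ncard :=
        Set.ncard_le_ncard hsub (hA.finite.union (Set.finite_of_encard_eq_coe h))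
    _ ≤ A.ncard + (symmDiff A B).ncard := Set.ncard_union_le _ _
    _ = A.ncard + 1 := by rw [Set.ncard, Set.ncard, h]; rfl

end Classes

section ClosedNeighbors

variable {V : Type*} [DecidableEq V] {X : SimpleGraph V} [X.LocallyFinite] {A B : Finset V}

variable (X) in
/-- The vertices of `X` adjacent to some vertex of the finite set `A`. -/
def neighbors (A : Finset V) : Finset V := A.biUnion fun v => X.neighborFinset v

variable (X) in
/-- The closed neighbourhood `A ∪ ∂A` of a finite set. For sets of a given size, comparing these is
the same as comparing vertex boundaries, and they behave better under unions. -/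
def closedNeighbors (A : Finset V) : Finset V := A ∪ neighbors X A

theorem mem_neighbors {u : V} : u ∈ neighbors X A ↔ ∃ v ∈ A, X.Adj v u := by
  simp only [neighbors, Finset.mem_biUnion, SimpleGraph.mem_neighborFinset]

theorem mem_closedNeighbors {u : V} : u ∈ closedNeighbors X A ↔ u ∈ A ∨ ∃ v ∈ A, X.Adj v u := by
  rw [closedNeighbors, Finset.mem_union, mem_neighbors]

theorem closedNeighbors_union (A B : Finset V) :
    closedNeighbors X (A ∪ B) = closedNeighbors X A ∪ closedNeighbors X B := by
  rw [closedNeighbors, neighbors, Finset.union_biUnion, Finset.union_union_union_comm]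
  rfl

theorem closedNeighbors_image (φ : X ≃g X) (A : Finset V) :
    closedNeighbors X (A.image φ) = (closedNeighbors X A).image φ := by
  ext u
  obtain ⟨u, rfl⟩ := φ.surjective u
  rw [φ.injective.mem_finset_image, mem_closedNeighbors, mem_closedNeighbors,
    φ.injective.mem_finset_image]
  simp only [Finset.exists_mem_image, φ.map_adj_iff]

theorem encard_vertexBoundary_add_card (A : Finset V) :
    (vertexBoundary X (A : Set V)).encard + A.card = (closedNeighbors X A).card := by
  have hdisj : Disjoint (vertexBoundary X (A : Set V)) A :=
    Set.disjoint_left.2 fun _ h => h.1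
  rw [← Set.encard_coe_eq_coe_finsetCard A, ← Set.encard_union_eq hdisj,
    ← Set.encard_coe_eq_coe_finsetCard]
  congr 1
  ext u
  simp only [vertexBoundary, Set.mem_union, Set.mem_ofPred_eq, Finset.mem_coe,
    mem_closedNeighbors, X.adj_comm u]
  grind

theorem isMinimal_iff_card_closedNeighbors_le : IsMinimal X (A : Set V) ↔
    A.Nonempty ∧ ∀ B : Finset V, B.card = A.card →
      (closedNeighbors X A).card ≤ (closedNeighbors X B).card := by
  have hle (B : Finset V) (hB : B.card = A.card) :
      (vertexBoundary X (A : Set V)).encard ≤ (vertexBoundary X (B : Set V)).encard ↔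
        (closedNeighbors X A).card ≤ (closedNeighbors X B).card := by
    rw [← Nat.cast_le (α := ℕ∞), ← encard_vertexBoundary_add_card,
      ← encard_vertexBoundary_add_card, hB,
      ENat.add_le_add_iff_right (ENat.natCast_ne_top _)]
  constructor
  · rintro ⟨hne, -, hmin⟩
    refine ⟨Finset.coe_nonempty.1 hne, fun B hB => (hle B hB).1 (hmin B ?_)⟩
    simp only [Set.encard_coe_eq_coe_finsetCard, hB]
  · rintro ⟨hne, hmin⟩
    refine ⟨Finset.coe_nonempty.2 hne, A.finite_toSet, fun B hB => ?_⟩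
    obtain ⟨B, rfl⟩ := (Set.finite_of_encard_eq_coe
      (hB.trans (Set.encard_coe_eq_coe_finsetCard A))).exists_finset_coe
    simp only [Set.encard_coe_eq_coe_finsetCard, Nat.cast_inj] at hB
    exact (hle B hB).2 (hmin B hB)

/-- Otherwise moving `B` by `φ` would merge the two boundaries and shrink the total. -/
theorem IsMinimal.disjoint_closedNeighbors_image (h : IsMinimal X (↑(A ∪ B) : Set V))
    (hAB : Disjoint (closedNeighbors X A) (closedNeighbors X B)) (φ : X ≃g X)
    (hφ : Disjoint A (B.image φ)) :
    Disjoint (closedNeighbors X A) (closedNeighbors X (B.image φ)) := by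
  have hAB' : Disjoint A B := hAB.mono Finset.subset_union_left Finset.subset_union_left
  have hcard : (A ∪ B.image φ).card = (A ∪ B).card := by
    rw [Finset.card_union_of_disjoint hφ, Finset.card_union_of_disjoint hAB',
      Finset.card_image_of_injective _ φ.injective]
  have hle := (isMinimal_iff_card_closedNeighbors_le.1 h).2 _ hcard
  have hinter := Finset.card_union_add_card_inter (closedNeighbors X A)
    (closedNeighbors X (B.image φ))
  rw [closedNeighbors_union, closedNeighbors_union, Finset.card_union_of_disjoint hAB] at hle
  rw [closedNeighbors_image φ B, Finset.card_image_of_injective _ φ.injective,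
    ← closedNeighbors_image] at hinter
  rw [Finset.disjoint_iff_inter_eq_empty, ← Finset.card_eq_zero]
  omega

theorem filter_closedNeighbors (C : X.Coloring Bool) (A : Finset V) (i : Bool) :
    {v ∈ closedNeighbors X A | C v = i} =
      {v ∈ A | C v = i} ∪ neighbors X {v ∈ A | C v = !i} := by
  ext u
  simp only [Finset.mem_filter, Finset.mem_union, mem_closedNeighbors, mem_neighbors]
  have hadj : ∀ v, X.Adj v u → (C u = i ↔ C v = !i) := fun v h => by
    have := C.valid h
    grind
  grind

end ClosedNeighbors

/-! ### Sumsets in products of ordered groups -/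

theorem card_filter_snd_add_le {α β : Type*} [AddCommMonoid α] [LinearOrder α]
    [IsOrderedCancelAddMonoid α] [AddZeroClass β] [DecidableEq β] {Y : Finset (α × β)}
    {S : Finset α} (hS : S.Nonempty) {b : β} (hb : b ∈ Y.image Prod.snd) :
    {y ∈ Y | y.2 = b}.card + (S.card - 1) ≤
      {p ∈ (Y + S ×ˢ {0} : Finset (α × β)) | p.2 = b}.card := by
  set F := {y ∈ Y | y.2 = b}.image Prod.fst
  have hF : F.Nonempty := by
    obtain ⟨y, hy, rfl⟩ := Finset.mem_image.1 hb
    exact ⟨y.1, Finset.mem_image_of_mem _ (Finset.mem_filter.2 ⟨hy, rfl⟩)⟩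
  have hFcard : F.card = {y ∈ Y | y.2 = b}.card := Finset.card_image_of_injOn <| by
    rintro ⟨a, c⟩ h ⟨a', c'⟩ h' rfl
    simp only [Finset.coe_filter, Set.mem_ofPred_eq] at h h'
    rw [h.2, h'.2]
  have hsub : (F + S).image (·, b) ⊆
      {p ∈ (Y + S ×ˢ {0} : Finset (α × β)) | p.2 = b} := by
    intro p hp
    obtain ⟨c, hc, rfl⟩ := Finset.mem_image.1 hp
    obtain ⟨a, ha, t, ht, rfl⟩ := Finset.mem_add.1 hc
    obtain ⟨y, hy, rfl⟩ := Finset.mem_image.1 ha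
    obtain ⟨hy, hyb⟩ := Finset.mem_filter.1 hy
    refine Finset.mem_filter.2 ⟨Finset.mem_add.2 ⟨y, hy, (t, 0), ?_, ?_⟩, rfl⟩
    · exact Finset.mk_mem_product ht (Finset.mem_singleton_self 0)
    · exact Prod.ext rfl ((add_zero _).trans hyb)
  calc _ = F.card + S.card - 1 := by rw [hFcard, Nat.add_sub_assoc hS.card_pos]
    _ ≤ (F + S).card := cauchy_davenport_add_of_linearOrder_isCancelAdd hF hS
    _ = ((F + S).image (·, b)).card := (Finset.card_image_of_injective _
      fun _ _ h => (Prod.ext_iff.1 h).1).symm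
    _ ≤ _ := Finset.card_le_card hsub

theorem card_add_mul_le_card_add_product_zero {α β : Type*} [AddCommMonoid α] [LinearOrder α]
    [IsOrderedCancelAddMonoid α] [AddZeroClass β] [DecidableEq β] (Y : Finset (α × β))
    {S : Finset α} (hS : S.Nonempty) :
    Y.card + (Y.image Prod.snd).card * (S.card - 1) ≤ (Y + S ×ˢ {0}).card := by
  have hsnd : Set.MapsTo Prod.snd ((Y + S ×ˢ {0} : Finset (α × β)) : Set (α × β))
      (Y.image Prod.snd) := by
    intro p hp
    obtain ⟨y, hy, t, ht, rfl⟩ := Finset.mem_add.1 (Finset.mem_coe.1 hp)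
    rw [Finset.mem_product, Finset.mem_singleton] at ht
    rw [Prod.snd_add, ht.2, add_zero]
    exact Finset.mem_image_of_mem _ hy
  rw [Finset.card_eq_sum_card_fiberwise hsnd, Finset.card_eq_sum_card_image Prod.snd Y,
    ← smul_eq_mul, ← Finset.sum_const, ← Finset.sum_add_distrib]
  exact Finset.sum_le_sum fun _ => card_filter_snd_add_le hS

theorem card_add_mul_le_card_add_zero_product {α β : Type*} [AddZeroClass α] [DecidableEq α]
    [AddCommMonoid β] [LinearOrder β] [IsOrderedCancelAddMonoid β]
    (Y : Finset (α × β)) {T : Finset β} (hT : T.Nonempty) :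
    Y.card + (Y.image Prod.fst).card * (T.card - 1) ≤ (Y + {0} ×ˢ T).card := by
  have h := card_add_mul_le_card_add_product_zero (Y.image Prod.swap) hT
  have hadd : Y.image Prod.swap + T ×ˢ {0} = (Y + {0} ×ˢ T).image Prod.swap := by
    rw [← Finset.image_swap_product]
    exact (Finset.image_add (AddEquiv.prodComm (M := α) (N := β))).symm
  rwa [hadd, Finset.card_image_of_injective _ Prod.swap_injective,
    Finset.card_image_of_injective _ Prod.swap_injective, Finset.image_image] at h

theorem card_add_mul_le_card_add_product {α β : Type*} [AddCommMonoid α] [LinearOrder α]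
    [IsOrderedCancelAddMonoid α] [AddCommMonoid β] [LinearOrder β] [IsOrderedCancelAddMonoid β]
    {Y : Finset (α × β)} {S : Finset α} {T : Finset β} (hY : Y.Nonempty) (hS : S.Nonempty)
    (hT : T.Nonempty) :
    Y.card + (Y.image Prod.snd).card * (S.card - 1) +
      ((Y.image Prod.fst).card + S.card - 1) * (T.card - 1) ≤ (Y + S ×ˢ T).card := by
  have hsplit : Y + S ×ˢ T = Y + S ×ˢ {0} + {0} ×ˢ T := by
    rw [add_assoc, Finset.product_add_product_comm, Finset.singleton_zero, Finset.singleton_zero,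
      add_zero, zero_add]
  have hfst : (Y + S ×ˢ {0}).image Prod.fst = Y.image Prod.fst + S := by
    conv_rhs => rw [← Finset.product_image_fst (s := S) (Finset.singleton_nonempty (0 : β))]
    exact Finset.image_add (AddMonoidHom.fst α β)
  rw [hsplit]
  refine le_trans ?_ (card_add_mul_le_card_add_zero_product _ hT)
  rw [hfst]
  gcongr
  · exact card_add_mul_le_card_add_product_zero Y hS
  · exact cauchy_davenport_add_of_linearOrder_isCancelAdd (hY.image _) hS

theorem mem_add_pair {α : Type*} [AddCommGroup α] [DecidableEq α] {S : Finset α} {a b x : α} :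
    x ∈ S + {a, b} ↔ x - a ∈ S ∨ x - b ∈ S := by
  simp only [Finset.mem_add, Finset.mem_insert, Finset.mem_singleton, or_and_right, exists_or,
    and_or_left, exists_eq_left, ← eq_sub_iff_add_eq, exists_eq_right]

theorem card_add_one_le_card_add_neg_one_one {S : Finset ℤ} (hS : S.Nonempty) :
    S.card + 1 ≤ (S + {-1, 1}).card := by
  have h := cauchy_davenport_add_of_linearOrder_isCancelAdd hS (Finset.insert_nonempty (-1) {1})
  rwa [Finset.card_pair (by decide)] at h

theorem exists_eq_image_range_of_card_add_le {S : Finset ℤ}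
    (hS : (S + {-1, 1}).card ≤ S.card + 1) :
    ∃ a : ℤ, S = (Finset.range S.card).image fun i : ℕ => a + 2 * (i : ℤ) := by
  induction S using Finset.induction_on_min with
  | empty => exact ⟨0, rfl⟩
  | insert m S hmS ih =>
    refine ⟨m, ?_⟩
    have hm : m ∉ S := fun h => (hmS m h).false
    rw [Finset.card_insert_of_notMem hm] at hS ⊢
    rcases S.eq_empty_or_nonempty with rfl | hne
    · simp
    have hlow : m - 1 ∉ S + {-1, 1} := by grind [mem_add_pair]
    have hsub : insert (m - 1) (S + {-1, 1}) ⊆ insert m S + {-1, 1} := by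
      intro x
      simp only [Finset.mem_insert, mem_add_pair]
      grind
    have hle := Finset.card_le_card hsub
    have hcd := card_add_one_le_card_add_neg_one_one hne
    have hmid : m + 1 ∈ insert (m - 1) (S + {-1, 1}) := by
      rw [Finset.eq_of_subset_of_card_le hsub (by grind), mem_add_pair]
      exact .inr (by simp)
    rw [Finset.card_insert_of_notMem hlow] at hle
    obtain ⟨a, ha⟩ := ih (by omega)
    have hmem (x : ℤ) : x ∈ S ↔ ∃ i < S.card, a + 2 * (i : ℤ) = x := by
      conv_lhs => rw [ha]
      simp only [Finset.mem_image, Finset.mem_range]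
    have ham : a = m + 2 := by
      have hma : m < a := hmS a ((hmem a).2 ⟨0, hne.card_pos, by simp⟩)
      rw [Finset.mem_insert, mem_add_pair, hmem, hmem] at hmid
      rcases hmid with h | ⟨i, -, h⟩ | ⟨i, -, h⟩ <;> omega
    nth_rewrite 1 [ha]
    rw [Finset.range_add_one', Finset.image_insert, Finset.map_eq_image, Finset.image_image, ham]
    congr 1
    · simp
    · refine Finset.image_congr fun i _ => ?_
      change m + 2 + 2 * (i : ℤ) = m + 2 * ((i + 1 : ℕ) : ℤ)
      push_cast
      ring

/-! ### The lattice in diagonal coordinates -/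

/-- The diagonal coordinates `(x + y, x - y)`. They turn the four unit steps of the lattice into
`{-1, 1} ×ˢ {-1, 1}`. -/
def diag : ℤ × ℤ →+ ℤ × ℤ :=
  (AddMonoidHom.fst ℤ ℤ + AddMonoidHom.snd ℤ ℤ).prod (AddMonoidHom.fst ℤ ℤ - AddMonoidHom.snd ℤ ℤ)

theorem diag_apply (p : ℤ × ℤ) : diag p = (p.1 + p.2, p.1 - p.2) := rfl

theorem diag_injective : Function.Injective diag := by
  rintro ⟨x, y⟩ ⟨x', y'⟩ h
  simp only [diag_apply, Prod.mk.injEq] at h ⊢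
  omega

/-- The neighbours of the origin in the lattice. -/
def unitSteps : Finset (ℤ × ℤ) := {(1, 0), (-1, 0), (0, 1), (0, -1)}

theorem lattice_adj_iff_sub_mem_unitSteps {p q : ℤ × ℤ} :
    lattice.Adj p q ↔ q - p ∈ unitSteps := by
  obtain ⟨x, y⟩ := p
  obtain ⟨x', y'⟩ := q
  simp only [lattice, unitSteps, Finset.mem_insert, Finset.mem_singleton, Prod.mk_sub_mk,
    Prod.mk.injEq]
  grind

theorem image_diag_unitSteps : unitSteps.image diag = ({-1, 1} ×ˢ {-1, 1} : Finset (ℤ × ℤ)) := by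
  decide

instance : lattice.LocallyFinite := fun p =>
  Fintype.ofFinset ({p} + unitSteps) fun q => by
    rw [SimpleGraph.mem_neighborSet, lattice_adj_iff_sub_mem_unitSteps, Finset.singleton_add,
      Finset.mem_vadd_finset]
    simp [vadd_eq_add, ← eq_sub_iff_add_eq']

theorem neighbors_lattice (A : Finset (ℤ × ℤ)) : neighbors lattice A = A + unitSteps := by
  ext q
  rw [mem_neighbors, Finset.mem_add]
  simp only [lattice_adj_iff_sub_mem_unitSteps, ← eq_sub_iff_add_eq', exists_eq_right]

theorem closedNeighbors_lattice (A : Finset (ℤ × ℤ)) :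
    closedNeighbors lattice A = A + insert 0 unitSteps := by
  rw [closedNeighbors, neighbors_lattice, Finset.insert_eq, Finset.add_union,
    Finset.singleton_zero, add_zero]

/-- Translation by `c`, as an automorphism of the lattice. -/
def translation (c : ℤ × ℤ) : lattice ≃g lattice where
  toEquiv := Equiv.addLeft c
  map_rel_iff' := by
    simp only [lattice_adj_iff_sub_mem_unitSteps, Equiv.coe_addLeft, add_sub_add_left_eq_sub,
      implies_true]

theorem translation_apply (c p : ℤ × ℤ) : translation c p = c + p := rfl

theorem image_translation (c : ℤ × ℤ) (A : Finset (ℤ × ℤ)) : A.image (translation c) = {c} + A :=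
  (Finset.singleton_add c).symm

theorem image_diag_neighbors (A : Finset (ℤ × ℤ)) :
    (neighbors lattice A).image diag =
      A.image diag + ({-1, 1} ×ˢ {-1, 1} : Finset (ℤ × ℤ)) := by
  rw [neighbors_lattice, Finset.image_add, image_diag_unitSteps]

theorem card_image_diag (A : Finset (ℤ × ℤ)) : (A.image diag).card = A.card :=
  Finset.card_image_of_injective A diag_injective

/-- The half-perimeter of `A` in diagonal coordinates: the sum of the sizes of the two projections
of `A` along the diagonals. -/
def halfPerimeter (A : Finset (ℤ × ℤ)) : ℕ :=
  ((A.image diag).image Prod.fst).card + ((A.image diag).image Prod.snd).card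

theorem card_add_halfPerimeter_lt_card_neighbors {A : Finset (ℤ × ℤ)} (hA : A.Nonempty) :
    A.card + halfPerimeter A < (neighbors lattice A).card := by
  have hpair : ({-1, 1} : Finset ℤ).card = 2 := by decide
  have h := card_add_mul_le_card_add_product (hA.image diag) (Finset.insert_nonempty (-1) {1})
    (Finset.insert_nonempty (-1) {1})
  rw [← image_diag_neighbors, card_image_diag, card_image_diag, hpair] at h
  rw [halfPerimeter]
  omega

theorem card_le_card_fst_mul_card_snd (A : Finset (ℤ × ℤ)) :
    A.card ≤ ((A.image diag).image Prod.fst).card * ((A.image diag).image Prod.snd).card := by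
  rw [← card_image_diag, ← Finset.card_product]
  exact Finset.card_le_card Finset.subset_product

theorem four_mul_card_le_halfPerimeter_sq (A : Finset (ℤ × ℤ)) :
    4 * A.card ≤ halfPerimeter A ^ 2 := by
  have h := card_le_card_fst_mul_card_snd A
  have hsq := four_mul_le_sq_add ((A.image diag).image Prod.fst).card
    ((A.image diag).image Prod.snd).card
  rw [halfPerimeter]
  linarith

/-! ### The isoperimetric inequality -/

theorem card_filter_add_card_filter_not_eq {V : Type*} (C : V → Bool) (A : Finset V) (i : Bool) :
    {v ∈ A | C v = i}.card + {v ∈ A | C v = !i}.card = A.card := by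
  simpa only [Bool.eq_not] using Finset.card_filter_add_card_filter_not (s := A) (C · = i)

/-- The bipartition of the lattice by the parity of the sum of the coordinates; `true` is even. -/
def parity : lattice.Coloring Bool :=
  SimpleGraph.Coloring.mk (fun p => decide (Even (p.1 + p.2))) fun {p q} h => by
    have h' := lattice_adj_iff_sub_mem_unitSteps.1 h
    simp only [unitSteps, Finset.mem_insert, Finset.mem_singleton, Prod.ext_iff, Prod.fst_sub,
      Prod.snd_sub] at h'
    simp only [ne_eq, decide_eq_decide, Int.even_iff]
    omega

/-- The points of `A` of parity `i`. -/
def parityPart (i : Bool) (A : Finset (ℤ × ℤ)) : Finset (ℤ × ℤ) := {p ∈ A | parity p = i}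

theorem card_parityPart_add (i : Bool) (A : Finset (ℤ × ℤ)) :
    (parityPart i A).card + (parityPart (!i) A).card = A.card :=
  card_filter_add_card_filter_not_eq parity A i

theorem parityPart_union (i : Bool) (A : Finset (ℤ × ℤ)) :
    parityPart i A ∪ parityPart (!i) A = A := by
  simpa only [parityPart, Bool.eq_not] using Finset.filter_union_filter_not_eq (parity · = i) A

theorem card_closedNeighbors_eq (i : Bool) (A : Finset (ℤ × ℤ)) :
    (closedNeighbors lattice A).card =
      (parityPart i A ∪ neighbors lattice (parityPart (!i) A)).card +
        (parityPart (!i) A ∪ neighbors lattice (parityPart i A)).card := by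
  rw [← card_filter_add_card_filter_not_eq parity _ i, filter_closedNeighbors,
    filter_closedNeighbors, Bool.not_not]
  rfl

theorem exists_halfPerimeter_parityPart_le {A : Finset (ℤ × ℤ)} (hA : A.Nonempty) :
    ∃ i, halfPerimeter (parityPart (!i) A) ≤ halfPerimeter (parityPart i A) ∧
      (parityPart i A).Nonempty := by
  obtain ⟨i, hi⟩ : ∃ i, halfPerimeter (parityPart (!i) A) ≤ halfPerimeter (parityPart i A) := by
    rcases le_total (halfPerimeter (parityPart true A)) (halfPerimeter (parityPart false A))
      with h | h
    exacts [⟨false, h⟩, ⟨true, h⟩]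
  refine ⟨i, hi, Finset.nonempty_iff_ne_empty.2 fun h => ?_⟩
  have hcard := card_parityPart_add i A
  have hsq := four_mul_card_le_halfPerimeter_sq (parityPart (!i) A)
  rw [h] at hi hcard
  rw [Nat.le_zero.1 hi] at hsq
  have := hA.card_pos
  rw [Finset.card_empty] at hcard
  omega

theorem two_mul_card_parityPart_add_lt {i : Bool} {A : Finset (ℤ × ℤ)}
    (hX : (parityPart i A).Nonempty) :
    2 * (parityPart i A).card + halfPerimeter (parityPart i A) <
      (closedNeighbors lattice A).card := by
  have h := card_add_halfPerimeter_lt_card_neighbors hX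
  have h₁ := Finset.card_le_card (Finset.subset_union_left (s₁ := parityPart i A)
    (s₂ := neighbors lattice (parityPart (!i) A)))
  have h₂ := Finset.card_le_card (Finset.subset_union_right (s₁ := parityPart (!i) A)
    (s₂ := neighbors lattice (parityPart i A)))
  rw [card_closedNeighbors_eq i]
  omega

theorem card_add_halfPerimeter_add_lt {i : Bool} {A : Finset (ℤ × ℤ)}
    (hX : (parityPart i A).Nonempty) :
    A.card + halfPerimeter (parityPart i A) + halfPerimeter (parityPart (!i) A) + 1 <
      (closedNeighbors lattice A).card := by
  have hA := card_parityPart_add i A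
  rcases (parityPart (!i) A).eq_empty_or_nonempty with hY | hY
  · have h := two_mul_card_parityPart_add_lt hX
    have := hX.card_pos
    rw [hY, Finset.card_empty] at hA
    have h0 : halfPerimeter ∅ = 0 := rfl
    rw [hY, h0]
    omega
  · have hX' := card_add_halfPerimeter_lt_card_neighbors hX
    have hY' := card_add_halfPerimeter_lt_card_neighbors hY
    have h₁ := Finset.card_le_card (Finset.subset_union_right (s₁ := parityPart i A)
      (s₂ := neighbors lattice (parityPart (!i) A)))
    have h₂ := Finset.card_le_card (Finset.subset_union_right (s₁ := parityPart (!i) A)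
      (s₂ := neighbors lattice (parityPart i A)))
    rw [card_closedNeighbors_eq i]
    omega

theorem eight_mul_add_lt_sq_add_four {e o s t k : ℕ} (ho : 4 * o ≤ t ^ 2) (hts : t + 3 ≤ s)
    (hk : s + t ≤ k) (hes : e + s ≤ o + k + 1) : 8 * (e + o) < k ^ 2 + 4 := by
  obtain ⟨m, rfl⟩ : ∃ m, k = 2 * t + 3 + m := Nat.exists_eq_add_of_le (by omega)
  have he : e ≤ o + t + 1 + m := by omega
  zify at *
  nlinarith [sq_nonneg ((m : ℤ) - 1), mul_nonneg (Int.natCast_nonneg t) (Int.natCast_nonneg m)]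

theorem eight_mul_add_add_le {e o s t k : ℕ} (he : 4 * e ≤ s ^ 2) (ho : 4 * o ≤ t ^ 2)
    (hts : t ≤ s) (hst : s ≤ t + 2) (hk : s + t ≤ k) : 8 * (e + o) ≤ k ^ 2 + 4 := by
  obtain ⟨d, rfl⟩ := Nat.exists_eq_add_of_le hts
  have : d ≤ 2 := by omega
  nlinarith

theorem eight_mul_card_le_sq_add_four {A : Finset (ℤ × ℤ)} {k : ℕ}
    (hk : (closedNeighbors lattice A).card ≤ A.card + (k + 2)) : 8 * A.card ≤ k ^ 2 + 4 := by
  rcases A.eq_empty_or_nonempty with rfl | hA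
  · simp
  obtain ⟨i, hi, hX⟩ := exists_halfPerimeter_parityPart_le hA
  have hX' := two_mul_card_parityPart_add_lt hX
  have hXY := card_add_halfPerimeter_add_lt hX
  have he := four_mul_card_le_halfPerimeter_sq (parityPart i A)
  have ho := four_mul_card_le_halfPerimeter_sq (parityPart (!i) A)
  rw [← card_parityPart_add i A] at hk hXY ⊢
  rcases le_or_gt (halfPerimeter (parityPart i A)) (halfPerimeter (parityPart (!i) A) + 2)
    with h | h
  · exact eight_mul_add_add_le he ho hi h (by omega)
  · exact (eight_mul_add_lt_sq_add_four ho h (by omega) (by omega)).le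

theorem isMinimal_of_card_closedNeighbors_le {A : Finset (ℤ × ℤ)} {j : ℕ}
    (hA : (closedNeighbors lattice A).card ≤ A.card + (j + 3)) (hj : j ^ 2 + 4 < 8 * A.card) :
    IsMinimal lattice (A : Set (ℤ × ℤ)) := by
  refine isMinimal_iff_card_closedNeighbors_le.2 ⟨Finset.card_pos.1 (by omega), fun B hB => ?_⟩
  by_contra! hlt
  have := eight_mul_card_le_sq_add_four (A := B) (k := j) (by omega)
  omega

theorem eq_of_add_eq_of_add_le {e o s t r : ℕ} (he : 4 * e ≤ s ^ 2) (ho : 4 * o ≤ t ^ 2)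
    (hts : t ≤ s) (heo : e + o = 2 * r ^ 2 + 2 * r + 1) (hst : s + t ≤ 4 * r + 2)
    (hes : e + s ≤ o + 4 * r + 3) : t = 2 * r ∧ o = r ^ 2 ∧ s = 2 * r + 2 ∧ e = (r + 1) ^ 2 := by
  have hst2 : s < t + 3 := by
    by_contra! h
    nlinarith [eight_mul_add_lt_sq_add_four ho h hst hes]
  obtain ⟨d, rfl⟩ := Nat.exists_eq_add_of_le hts
  have hd : d = 2 := by
    have hlt : 1 < d := by nlinarith
    omega
  subst hd
  have ht : t = 2 * r := by
    refine le_antisymm (by omega) ?_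
    by_contra! h
    nlinarith
  subst ht
  refine ⟨rfl, ?_, rfl, ?_⟩ <;> nlinarith

theorem exists_eq_closedNeighbors_of_card_le {A : Finset (ℤ × ℤ)} {r : ℕ} (hr : 0 < r)
    (hA : A.card = 2 * r ^ 2 + 2 * r + 1)
    (hNA : (closedNeighbors lattice A).card ≤ A.card + (4 * r + 4)) :
    ∃ Y : Finset (ℤ × ℤ), A = closedNeighbors lattice Y ∧ Y.card = r ^ 2 ∧
      halfPerimeter Y = 2 * r ∧ (neighbors lattice Y).card = (r + 1) ^ 2 := by
  obtain ⟨i, hi, hX⟩ := exists_halfPerimeter_parityPart_le (A := A) (Finset.card_pos.1 (by omega))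
  have hsum := card_parityPart_add i A
  have hlt₁ := two_mul_card_parityPart_add_lt hX
  have hlt₂ := card_add_halfPerimeter_add_lt hX
  obtain ⟨ht, ho, hs, he⟩ := eq_of_add_eq_of_add_le (r := r)
    (four_mul_card_le_halfPerimeter_sq (parityPart i A))
    (four_mul_card_le_halfPerimeter_sq (parityPart (!i) A)) hi (by omega) (by omega) (by omega)
  have hY : (parityPart (!i) A).Nonempty := Finset.card_pos.1 (ho ▸ pow_pos hr 2)
  have hXlt := card_add_halfPerimeter_lt_card_neighbors hX
  have hYlt := card_add_halfPerimeter_lt_card_neighbors hY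
  have hunion := Finset.card_le_card (Finset.subset_union_right (s₁ := parityPart (!i) A)
      (s₂ := neighbors lattice (parityPart i A)))
  rw [card_closedNeighbors_eq i] at hNA
  have hXY : parityPart i A ∪ neighbors lattice (parityPart (!i) A) = parityPart i A :=
    (Finset.eq_of_subset_of_card_le Finset.subset_union_left (by nlinarith)).symm
  have heq : neighbors lattice (parityPart (!i) A) = parityPart i A :=
    Finset.eq_of_subset_of_card_le (Finset.union_eq_left.1 hXY) (by nlinarith)
  refine ⟨parityPart (!i) A, ?_, ho, ht, by rw [heq, he]⟩
  rw [closedNeighbors, heq, Finset.union_comm, parityPart_union]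

/-- The `r ^ 2` points which in diagonal coordinates form the square `{0, 2, ..., 2 r - 2} ^ 2`. -/
def grid (r : ℕ) : Finset (ℤ × ℤ) :=
  (Finset.range r ×ˢ Finset.range r).image fun i => ((i.1 : ℤ) + i.2, (i.1 : ℤ) - i.2)

theorem eq_and_eq_of_sq_le_mul {a b r : ℕ} (h : r ^ 2 ≤ a * b) (hab : a + b = 2 * r) :
    a = r ∧ b = r := by
  zify at *
  have : ((a : ℤ) - b) ^ 2 = 0 := by nlinarith [sq_nonneg ((a : ℤ) - b)]
  have := pow_eq_zero_iff two_ne_zero |>.1 this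
  omega

theorem image_diag_add_grid (c : ℤ × ℤ) (r : ℕ) :
    ({c} + grid r).image diag = (Finset.range r).image (fun i : ℕ => (diag c).1 + 2 * (i : ℤ)) ×ˢ
      (Finset.range r).image (fun i : ℕ => (diag c).2 + 2 * (i : ℤ)) := by
  rw [← image_translation, grid, Finset.image_image, Finset.image_image,
    ← Finset.prodMap_image_product]
  refine Finset.image_congr fun i _ => ?_
  simp only [Function.comp_apply, translation_apply, map_add, diag_apply, Prod.mk_add_mk, Prod.map]
  ext <;> ring

theorem exists_eq_add_grid {Y : Finset (ℤ × ℤ)} {r : ℕ} (hr : 0 < r) (hY : Y.card = r ^ 2)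
    (hper : halfPerimeter Y = 2 * r) (hNY : (neighbors lattice Y).card = (r + 1) ^ 2) :
    ∃ c, Y = {c} + grid r := by
  set S := (Y.image diag).image Prod.fst
  set D := (Y.image diag).image Prod.snd
  have hSD := card_le_card_fst_mul_card_snd Y
  obtain ⟨hSr, hDr⟩ : S.card = r ∧ D.card = r := eq_and_eq_of_sq_le_mul (hY ▸ hSD) hper
  have hprod : Y.image diag = S ×ˢ D := by
    refine Finset.eq_of_subset_of_card_le Finset.subset_product ?_
    rw [Finset.card_product, hSr, hDr, card_image_diag, hY, sq]
  have hspread : (S + {-1, 1}).card * (D + {-1, 1}).card = (r + 1) * (r + 1) := by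
    rw [← Finset.card_product, ← Finset.product_add_product_comm, ← hprod, ← image_diag_neighbors,
      card_image_diag, hNY, sq]
  have hS' := card_add_one_le_card_add_neg_one_one (Finset.card_pos.1 (hSr ▸ hr))
  have hD' := card_add_one_le_card_add_neg_one_one (Finset.card_pos.1 (hDr ▸ hr))
  rw [hSr] at hS'
  rw [hDr] at hD'
  obtain ⟨a, ha⟩ := exists_eq_image_range_of_card_add_le (S := S) (by rw [hSr]; nlinarith)
  obtain ⟨b, hb⟩ := exists_eq_image_range_of_card_add_le (S := D) (by rw [hDr]; nlinarith)
  rw [hSr] at ha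
  rw [hDr] at hb
  obtain ⟨c, -, hc⟩ : ∃ c ∈ Y, diag c = (a, b) := by
    rw [← Finset.mem_image, hprod, ha, hb]
    exact Finset.mk_mem_product (Finset.mem_image.2 ⟨0, Finset.mem_range.2 hr, by simp⟩)
      (Finset.mem_image.2 ⟨0, Finset.mem_range.2 hr, by simp⟩)
  refine ⟨c, Finset.image_injective diag_injective ?_⟩
  rw [hprod, ha, hb, image_diag_add_grid, hc]

theorem exists_eq_add_closedNeighbors_grid {A : Finset (ℤ × ℤ)} {r : ℕ} (hr : 0 < r)
    (hA : A.card = 2 * r ^ 2 + 2 * r + 1)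
    (hNA : (closedNeighbors lattice A).card ≤ A.card + (4 * r + 4)) :
    ∃ c, A = {c} + closedNeighbors lattice (grid r) := by
  obtain ⟨Y, rfl, hY, hper, hNY⟩ := exists_eq_closedNeighbors_of_card_le hr hA hNA
  obtain ⟨c, rfl⟩ := exists_eq_add_grid hr hY hper hNY
  exact ⟨c, by rw [closedNeighbors_lattice, closedNeighbors_lattice, add_assoc]⟩

theorem congruent_of_card_eq {A B : Finset (ℤ × ℤ)} {r : ℕ} (hr : 0 < r)
    (hA : A.card = 2 * r ^ 2 + 2 * r + 1) (hB : B.card = 2 * r ^ 2 + 2 * r + 1)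
    (hNA : (closedNeighbors lattice A).card ≤ A.card + (4 * r + 4))
    (hNB : (closedNeighbors lattice B).card ≤ B.card + (4 * r + 4)) :
    Congruent lattice (A : Set (ℤ × ℤ)) (B : Set (ℤ × ℤ)) := by
  obtain ⟨a, rfl⟩ := exists_eq_add_closedNeighbors_grid hr hA hNA
  obtain ⟨b, rfl⟩ := exists_eq_add_closedNeighbors_grid hr hB hNB
  have h := congruent_image (translation (b - a)) ({a} + closedNeighbors lattice (grid r))
  rwa [image_translation, ← add_assoc, Finset.singleton_add_singleton, sub_add_cancel] at h

/-! ### Growing boxes -/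

/-- In diagonal coordinates, the box of side lengths `P` and `Q` with the first `t` cells of the
next row; only the cells in the image of `diag` contain a lattice point. -/
noncomputable def stair (P Q t : ℕ) : Finset (ℤ × ℤ) :=
  (Finset.Ico 0 (P : ℤ) ×ˢ Finset.Ico 0 (Q : ℤ) ∪ {(P : ℤ)} ×ˢ Finset.Ico 0 (t : ℤ)).preimage diag
    diag_injective.injOn

theorem mem_stair {P Q t : ℕ} {p : ℤ × ℤ} : p ∈ stair P Q t ↔ 0 ≤ p.1 - p.2 ∧
    (0 ≤ p.1 + p.2 ∧ p.1 + p.2 < P ∧ p.1 - p.2 < Q ∨ p.1 + p.2 = P ∧ p.1 - p.2 < t) := by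
  simp only [stair, Finset.mem_preimage, Finset.mem_union, Finset.mem_product, diag_apply,
    Finset.mem_Ico, Finset.mem_singleton]
  tauto

theorem stair_zero_zero (Q : ℕ) : stair 0 Q 0 = ∅ := by
  refine Finset.eq_empty_of_forall_notMem fun p hp => ?_
  rw [mem_stair] at hp
  omega

theorem stair_self (P Q : ℕ) : stair P Q Q = stair (P + 1) Q 0 := by
  ext p
  simp only [mem_stair]
  omega

theorem exists_stair_succ_eq_insert {P t : ℕ} (Q : ℕ) (h : t % 2 = P % 2) :
    ∃ p ∉ stair P Q t, stair P Q (t + 1) = insert p (stair P Q t) := by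
  refine ⟨((P + t) / 2, (P - t) / 2), ?_, ?_⟩
  · rw [mem_stair]
    omega
  · ext ⟨x, y⟩
    simp only [Finset.mem_insert, mem_stair, Prod.mk.injEq]
    omega

theorem stair_succ_eq {P t : ℕ} (Q : ℕ) (h : t % 2 ≠ P % 2) :
    stair P Q (t + 1) = stair P Q t := by
  ext p
  simp only [mem_stair]
  omega

theorem card_stair_eq_add (P Q t : ℕ) :
    (stair P Q t).card = (stair P Q 0).card + (t + (P + 1) % 2) / 2 := by
  induction t with
  | zero => omega
  | succ t ih =>
    by_cases h : t % 2 = P % 2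
    · obtain ⟨p, hp, heq⟩ := exists_stair_succ_eq_insert Q h
      rw [heq, Finset.card_insert_of_notMem hp]
      omega
    · rw [stair_succ_eq Q h]
      omega

theorem card_stair_zero (P Q : ℕ) : (stair P Q 0).card = (P * Q + 1) / 2 := by
  induction P with
  | zero => rw [stair_zero_zero, Finset.card_empty, Nat.zero_mul]
  | succ P ih =>
    rw [← stair_self, card_stair_eq_add, ih]
    obtain ⟨a, rfl | rfl⟩ := Nat.even_or_odd' P <;> ring_nf <;> omega

theorem card_stair (P Q t : ℕ) :
    (stair P Q t).card = (P * Q + 1) / 2 + (t + (P + 1) % 2) / 2 := by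
  rw [card_stair_eq_add, card_stair_zero]

theorem card_closedNeighbors_le_of_forall {A B : Finset (ℤ × ℤ)}
    (h : ∀ p ∈ A, ∀ q ∈ insert 0 unitSteps, (1, 0) + (p + q) ∈ B) :
    (closedNeighbors lattice A).card ≤ B.card := by
  rw [← Finset.card_image_of_injective _ (translation (1, 0)).injective, closedNeighbors_lattice]
  refine Finset.card_le_card (Finset.image_subset_iff.2 fun u hu => ?_)
  obtain ⟨p, hp, q, hq, rfl⟩ := Finset.mem_add.1 hu
  exact h p hp q hq

theorem card_closedNeighbors_stair_zero_le (P Q : ℕ) :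
    (closedNeighbors lattice (stair P Q 0)).card ≤ (stair P Q 0).card + (P + Q + 2) := by
  calc (closedNeighbors lattice (stair P Q 0)).card ≤ (stair (P + 2) (Q + 2) 0).card := by
        refine card_closedNeighbors_le_of_forall fun p hp q hq => ?_
        simp only [unitSteps, Finset.mem_insert, Finset.mem_singleton] at hq
        rw [mem_stair] at hp ⊢
        rcases hq with rfl | rfl | rfl | rfl | rfl <;>
          simp only [Prod.fst_add, Prod.snd_add, Prod.fst_zero, Prod.snd_zero] <;> omega
    _ = (stair P Q 0).card + (P + Q + 2) := by
      rw [card_stair_zero, card_stair_zero]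
      ring_nf
      omega

theorem card_closedNeighbors_stair_le {P Q t : ℕ} (ht : t ≤ Q) :
    (closedNeighbors lattice (stair P Q t)).card ≤ (stair P Q t).card + (P + Q + 3) := by
  calc (closedNeighbors lattice (stair P Q t)).card ≤ (stair (P + 2) (Q + 2) (t + 2)).card := by
        refine card_closedNeighbors_le_of_forall fun p hp q hq => ?_
        simp only [unitSteps, Finset.mem_insert, Finset.mem_singleton] at hq
        rw [mem_stair] at hp ⊢
        rcases hq with rfl | rfl | rfl | rfl | rfl <;>
          simp only [Prod.fst_add, Prod.snd_add, Prod.fst_zero, Prod.snd_zero] <;> omega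
    _ = (stair P Q t).card + (P + Q + 3) := by
      rw [card_stair, card_stair]
      ring_nf
      omega

theorem isMinimal_stair {P Q t : ℕ} (hP : 2 ≤ P) (hQ : Q = P ∨ Q = P + 1) (ht : t ≤ Q) :
    IsMinimal lattice (stair P Q t : Set (ℤ × ℤ)) := by
  have hcard := card_stair P Q t
  rcases Nat.eq_zero_or_pos ((t + (P + 1) % 2) / 2) with h | h
  · have heq : stair P Q 0 = stair P Q t := by
      refine Finset.eq_of_subset_of_card_le (fun p => ?_) ?_
      · simp only [mem_stair]
        omega
      · rw [card_stair_eq_add P Q t, h, add_zero]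
    rw [← heq] at hcard ⊢
    refine isMinimal_of_card_closedNeighbors_le (j := P + Q - 1) ?_ ?_
    · exact (card_closedNeighbors_stair_zero_le P Q).trans (by omega)
    · obtain ⟨m, rfl⟩ := Nat.exists_eq_add_of_le' hP
      rw [hcard, h]
      rcases hQ with rfl | rfl
      · rw [show m + 2 + (m + 2) - 1 = 2 * m + 3 by omega]
        ring_nf
        omega
      · rw [show m + 2 + (m + 2 + 1) - 1 = 2 * m + 4 by omega]
        ring_nf
        omega
  · refine isMinimal_of_card_closedNeighbors_le (card_closedNeighbors_stair_le ht) ?_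
    rw [hcard]
    rcases hQ with rfl | rfl <;> ring_nf <;> omega

/-- The reflection `(x, y) ↦ (x, -y)`, which exchanges the two diagonal coordinates. -/
def reflection : lattice ≃g lattice where
  toEquiv := (Equiv.refl ℤ).prodCongr (Equiv.neg ℤ)
  map_rel_iff' {p q} := by
    simp only [lattice, Equiv.prodCongr_apply, Prod.map, Equiv.refl_apply, Equiv.neg_apply,
      neg_sub_neg, abs_sub_comm q.2]

theorem reflection_apply (p : ℤ × ℤ) : reflection p = (p.1, -p.2) := rfl

theorem image_reflection_stair (P Q : ℕ) : (stair P Q 0).image reflection = stair Q P 0 := by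
  ext p
  obtain ⟨p, rfl⟩ := reflection.surjective p
  rw [reflection.injective.mem_finset_image, mem_stair, mem_stair, reflection_apply]
  omega

theorem congruent_stair (P Q : ℕ) :
    Congruent lattice (stair P Q 0 : Set (ℤ × ℤ)) (stair Q P 0 : Set (ℤ × ℤ)) :=
  image_reflection_stair P Q ▸ congruent_image reflection (stair P Q 0)

theorem reachable_stair {P Q t : ℕ} (hP : 2 ≤ P) (hQ : Q = P ∨ Q = P + 1) (ht : t ≤ Q)
    (h₀ : IsMinimal lattice (stair P Q 0 : Set (ℤ × ℤ)))
    (h₁ : IsMinimal lattice (stair P Q t : Set (ℤ × ℤ))) :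
    (minimalGraph lattice).Reachable h₀.congruenceClass h₁.congruenceClass := by
  induction t with
  | zero => exact .refl _
  | succ t ih =>
    have h := isMinimal_stair hP hQ (t.le_succ.trans ht)
    refine (ih (t.le_succ.trans ht) h).trans ?_
    by_cases hpar : t % 2 = P % 2
    · obtain ⟨p, hp, heq⟩ := exists_stair_succ_eq_insert Q hpar
      revert h₁
      rw [heq, Finset.coe_insert]
      exact fun h₁ => (h.adj_insert (Finset.mem_coe.not.2 hp) h₁).reachable
    · revert h₁
      rw [stair_succ_eq Q hpar]
      exact fun _ => .refl _

theorem reachable_stair_self {P Q : ℕ} (hP : 2 ≤ P) (hQ : Q = P ∨ Q = P + 1)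
    (h₀ : IsMinimal lattice (stair P Q 0 : Set (ℤ × ℤ)))
    (h₁ : IsMinimal lattice (stair (P + 1) Q 0 : Set (ℤ × ℤ))) :
    (minimalGraph lattice).Reachable h₀.congruenceClass h₁.congruenceClass := by
  revert h₁
  rw [← stair_self]
  exact reachable_stair hP hQ le_rfl h₀

/-- The class of the minimal set that is a square box of side `k + 2` in diagonal coordinates. -/
noncomputable def boxClass (k : ℕ) : MinimalClass lattice :=
  (isMinimal_stair (Nat.le_add_left 2 k) (.inl rfl) (Nat.zero_le _)).congruenceClass

theorem reachable_boxClass_succ (k : ℕ) :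
    (minimalGraph lattice).Reachable (boxClass k) (boxClass (k + 1)) := by
  have hk := Nat.le_add_left 2 k
  have h := isMinimal_stair hk (.inr rfl) (Nat.zero_le _)
  have h' := h.of_congruent (congruent_stair _ _)
  refine (reachable_stair_self hk (.inl rfl) _ h').trans ?_
  rw [← h.congruenceClass_eq h' (congruent_stair _ _)]
  exact reachable_stair_self hk (.inr rfl) h _

theorem reachable_boxClass (k : ℕ) :
    (minimalGraph lattice).Reachable (boxClass 0) (boxClass k) := by
  induction k with
  | zero => exact .refl _
  | succ k ih => exact ih.trans (reachable_boxClass_succ k)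

theorem strictMono_classSize_boxClass : StrictMono fun k => classSize (boxClass k) := by
  refine strictMono_nat_of_lt_succ fun k => ?_
  simp only [boxClass, classSize_congruenceClass, card_stair_zero]
  ring_nf
  omega

theorem infinite_supp_boxClass :
    ((minimalGraph lattice).connectedComponentMk (boxClass 0)).supp.Infinite :=
  Set.infinite_of_injective_forall_mem
    (fun _ _ h => strictMono_classSize_boxClass.injective (congrArg classSize h)) fun k =>
    SimpleGraph.ConnectedComponent.sound (reachable_boxClass k).symm

theorem subsingleton_classSize_eq {r : ℕ} (hr : 0 < r) :
    {v : MinimalClass lattice | classSize v = 2 * r ^ 2 + 2 * r + 1}.Subsingleton := by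
  have hle {A : Finset (ℤ × ℤ)} (hA : IsMinimal lattice (A : Set (ℤ × ℤ)))
      (hcard : A.card = 2 * r ^ 2 + 2 * r + 1) :
      (closedNeighbors lattice A).card ≤ A.card + (4 * r + 4) := by
    have hbox : (stair (2 * r + 1) (2 * r + 1) 0).card = A.card := by
      rw [card_stair_zero, hcard]
      ring_nf
      omega
    have h := card_closedNeighbors_stair_zero_le (2 * r + 1) (2 * r + 1)
    have := (isMinimal_iff_card_closedNeighbors_le.1 hA).2 _ hbox
    omega
  intro v hv w hw
  obtain ⟨A, hA, rfl⟩ := exists_congruenceClass_eq v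
  obtain ⟨B, hB, rfl⟩ := exists_congruenceClass_eq w
  rw [Set.mem_ofPred_eq, classSize_congruenceClass] at hv hw
  exact hA.congruenceClass_eq hB (congruent_of_card_eq hr hv hw (hle hA hv) (hle hB hw))

/-! ### Finiteness of the number of classes of bounded size -/

theorem exists_fst_bounds_of_mem_closedNeighbors {A : Finset (ℤ × ℤ)} {u : ℤ × ℤ}
    (hu : u ∈ closedNeighbors lattice A) : ∃ v ∈ A, v.1 - 1 ≤ u.1 ∧ u.1 ≤ v.1 + 1 := by
  rw [closedNeighbors_lattice] at hu
  obtain ⟨v, hv, q, hq, rfl⟩ := Finset.mem_add.1 hu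
  refine ⟨v, hv, ?_⟩
  simp only [unitSteps, Finset.mem_insert, Finset.mem_singleton] at hq
  rcases hq with rfl | rfl | rfl | rfl | rfl <;>
    simp only [Prod.fst_add, Prod.fst_zero] <;> omega

theorem exists_translation_not_disjoint_closedNeighbors {L R : Finset (ℤ × ℤ)}
    (hL : L.Nonempty) (hR : R.Nonempty) : ∃ c, Disjoint L (R.image (translation c)) ∧
      ¬Disjoint (closedNeighbors lattice L)
        (closedNeighbors lattice (R.image (translation c))) := by
  obtain ⟨l, hl, hlmax⟩ := L.exists_max_image Prod.fst hL
  obtain ⟨r, hr, hrmin⟩ := R.exists_min_image Prod.fst hR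
  refine ⟨l + (2, 0) - r, ?_, ?_⟩
  · rw [Finset.disjoint_left]
    intro p hp hp'
    obtain ⟨q, hq, rfl⟩ := Finset.mem_image.1 hp'
    have hle := hlmax _ hp
    have hge := hrmin q hq
    simp only [translation_apply, Prod.fst_add, Prod.fst_sub] at hle
    omega
  · rw [Finset.not_disjoint_iff]
    refine ⟨l + (1, 0), ?_, ?_⟩
    · rw [closedNeighbors_lattice]
      exact Finset.add_mem_add hl (by decide)
    · have heq : translation (l + (2, 0) - r) r + (-1, 0) = l + (1, 0) := by
        rw [translation_apply, sub_add_cancel, add_assoc]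
        rfl
      rw [closedNeighbors_lattice, ← heq]
      exact Finset.add_mem_add (Finset.mem_image_of_mem _ hr) (by decide)

theorem IsMinimal.exists_fst_eq {A : Finset (ℤ × ℤ)} (hA : IsMinimal lattice (A : Set (ℤ × ℤ)))
    {a b : ℤ × ℤ} (ha : a ∈ A) (hb : b ∈ A) {m : ℤ} (ham : a.1 ≤ m) (hmb : m < b.1) :
    ∃ w ∈ A, w.1 = m + 1 ∨ w.1 = m + 2 := by
  by_contra! hgap
  set L := {p ∈ A | p.1 ≤ m} with hL
  set R := {p ∈ A | ¬p.1 ≤ m} with hR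
  have hdisj : Disjoint (closedNeighbors lattice L) (closedNeighbors lattice R) := by
    rw [Finset.disjoint_left]
    intro u hu hu'
    obtain ⟨v, hv, -, hvu⟩ := exists_fst_bounds_of_mem_closedNeighbors hu
    obtain ⟨w, hw, hwu, -⟩ := exists_fst_bounds_of_mem_closedNeighbors hu'
    rw [hL, Finset.mem_filter] at hv
    rw [hR, Finset.mem_filter] at hw
    have := hgap w hw.1
    omega
  have hLR : L ∪ R = A := Finset.filter_union_filter_not_eq _ _
  obtain ⟨c, hc, hmeet⟩ := exists_translation_not_disjoint_closedNeighbors (L := L) (R := R)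
    ⟨a, Finset.mem_filter.2 ⟨ha, ham⟩⟩ ⟨b, Finset.mem_filter.2 ⟨hb, hmb.not_ge⟩⟩
  rw [← hLR] at hA
  exact hmeet (hA.disjoint_closedNeighbors_image hdisj _ hc)

theorem sub_le_two_mul_card {S : Finset ℤ} {a b : ℤ}
    (h : ∀ m, a ≤ m → m < b → m + 1 ∈ S ∨ m + 2 ∈ S) : b - a ≤ 2 * S.card := by
  have hsub : Finset.Icc (a + 1) b ⊆ S.image (· - 1) ∪ S := by
    intro x hx
    rw [Finset.mem_Icc] at hx
    obtain h | h := h (x - 1) (by omega) (by omega)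
    · exact Finset.mem_union_right _ (by rwa [sub_add_cancel] at h)
    · exact Finset.mem_union_left _ (Finset.mem_image.2 ⟨_, h, by ring⟩)
  have hle := (Finset.card_le_card hsub).trans (Finset.card_union_le _ _)
  have himage : (S.image (· - 1)).card ≤ S.card := Finset.card_image_le
  rw [Int.card_Icc] at hle
  omega

theorem IsMinimal.width_le {A : Finset (ℤ × ℤ)} (hA : IsMinimal lattice (A : Set (ℤ × ℤ)))
    {a b : ℤ × ℤ} (ha : a ∈ A) (hb : b ∈ A) : b.1 - a.1 ≤ 2 * A.card := by
  have h : b.1 - a.1 ≤ 2 * (A.image Prod.fst).card := by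
    refine sub_le_two_mul_card fun m ham hmb => ?_
    obtain ⟨w, hw, h | h⟩ := hA.exists_fst_eq ha hb ham hmb
    exacts [.inl (h ▸ Finset.mem_image_of_mem _ hw), .inr (h ▸ Finset.mem_image_of_mem _ hw)]
  have hcard : (A.image Prod.fst).card ≤ A.card := Finset.card_image_le
  omega

/-- The reflection `(x, y) ↦ (y, x)`, as an automorphism of the lattice. -/
def transposition : lattice ≃g lattice where
  toEquiv := Equiv.prodComm ℤ ℤ
  map_rel_iff' {p q} := by
    simp only [lattice, Equiv.prodComm_apply, Prod.fst_swap, Prod.snd_swap, add_comm]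

theorem IsMinimal.height_le {A : Finset (ℤ × ℤ)} (hA : IsMinimal lattice (A : Set (ℤ × ℤ)))
    {a b : ℤ × ℤ} (ha : a ∈ A) (hb : b ∈ A) : b.2 - a.2 ≤ 2 * A.card := by
  have h := (hA.of_congruent (congruent_image transposition A)).width_le
    (Finset.mem_image_of_mem _ ha) (Finset.mem_image_of_mem _ hb)
  rw [Finset.card_image_of_injective _ transposition.injective] at h
  exact h

theorem finite_classSize_le (n : ℕ) : {v : MinimalClass lattice | classSize v ≤ n}.Finite := by
  set box : Finset (ℤ × ℤ) := Finset.Icc 0 (2 * n : ℤ) ×ˢ Finset.Icc 0 (2 * n : ℤ)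
  have hfin : {A : {A : Set (ℤ × ℤ) // IsMinimal lattice A} | A.1 ⊆ (box : Set (ℤ × ℤ))}.Finite :=
    box.finite_toSet.finite_subsets.preimage Subtype.val_injective.injOn
  refine (hfin.image (Quotient.mk (congruence lattice))).subset fun v hv => ?_
  obtain ⟨A, hA, rfl⟩ := exists_congruenceClass_eq v
  rw [Set.mem_ofPred_eq, classSize_congruenceClass] at hv
  obtain ⟨a, ha, hamin⟩ := A.exists_min_image Prod.fst (Finset.coe_nonempty.1 hA.nonempty)
  obtain ⟨b, hb, hbmin⟩ := A.exists_min_image Prod.snd (Finset.coe_nonempty.1 hA.nonempty)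
  have hcong := congruent_image (translation (-a.1, -b.2)) A
  refine ⟨⟨_, hA.of_congruent hcong⟩, fun p hp => ?_, (Quotient.sound hcong).symm⟩
  obtain ⟨q, hq, rfl⟩ := Finset.mem_image.1 (Finset.mem_coe.1 hp)
  rw [Finset.mem_coe, Finset.mem_product, Finset.mem_Icc, Finset.mem_Icc, translation_apply,
    Prod.fst_add, Prod.snd_add]
  have hx := hamin q hq
  have hy := hbmin q hq
  have hwidth := hA.width_le ha hq
  have hheight := hA.height_le hb hq
  omega

theorem frequently_subsingleton_classSize_eq : ∃ᶠ m in atTop,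
    {v : MinimalClass lattice | classSize v = m}.Subsingleton := by
  exact frequently_atTop.2 fun n =>
    ⟨2 * (n + 1) ^ 2 + 2 * (n + 1) + 1, by nlinarith, subsingleton_classSize_eq n.succ_pos⟩

end MinimalSets

theorem mainTheorem8 :
    ∃! C : (MinimalSets.minimalGraph MinimalSets.lattice).ConnectedComponent,
      C.supp.Infinite := by
  refine ⟨_, MinimalSets.infinite_supp_boxClass, fun C hC => ?_⟩
  exact MinimalSets.eq_of_infinite_supp MinimalSets.classSize_le_of_adj
    MinimalSets.finite_classSize_le MinimalSets.frequently_subsingleton_classSize_eq hC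
    MinimalSets.infinite_supp_boxClass
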